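/- Let $\kappa$ be an uncountable strongly inaccessible cardinal (the cardinality of a chosen universe of small sets), and let $\mathsf{Class}$ be the category of all sets of cardinality at most $\kappa$ and all functions between them. A category is called small if it has fewer than $\kappa$ morphisms, and class-indexed if it has at most $\kappa$ morphisms. Let $H:\mathsf{Class}\to\mathsf{Class}$ be an arbitrary endofunctor, and let $\mathsf{Coalg}\,H$ be the category whose objects are the $H$-coalgebras, i.e. pairs $(A,\alpha)$ with $A$ in $\mathsf{Class}$ and $\alpha:A\to HA$ a function, and whose morphisms $(A,\alpha)\to(B,\beta)$ are the functions $f:A\to B$ with $Hf\circ\alpha=\beta\circ f$. Then: 1. $\mathsf{Coalg}\,H$ has all small limits: every diagram $D:\mathcal{D}\to\mathsf{Coalg}\,H$ with $\mathcal{D}$ small has a limit. 2. $\mathsf{Coalg}\,H$ has all class-indexed colimits: every diagram $D:\mathcal{D}\to\mathsf{Coalg}\,H$ with $\mathcal{D}$ class-indexed has a colimit. Moreover these colimits are created by the forgetful functor $U:\mathsf{Coalg}\,H\to\mathsf{Class}$: for each colimit cocone $c$ of $U\circ D$ there is precisely one cocone $d$ of $D$ in $\mathsf{Coalg}\,H$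 with $Ud=c$, and $d$ is a colimit cocone of $D$. -/

import Mathlib

open CategoryTheory CategoryTheory.Limits

universe u

/-- For a strongly inaccessible cardinal `κ` (the cardinality of the universe of small sets), the
category `Class` of classes: all sets of cardinality at most `κ`, with all functions between
them. -/
abbrev ClassCat (κ : Cardinal.{u}) : Type (u + 1) :=
  ObjectProperty.FullSubcategory (fun X : Type u => Cardinal.mk X ≤ κ)

/-- A category is small (relative to `κ`) if its set of morphisms has cardinality less than `κ`;
by means of identities, so does then its set of objects. -/
def IsSmallCat (κ : Cardinal.{u}) (J : Type u) [Category.{u} J] : Prop :=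
  Cardinal.mk (Arrow J) < κ

/-- A category is class-indexed (relative to `κ`) if it has only a class of morphisms, i.e. its
set of morphisms has cardinality at most `κ`. -/
def IsClassSizedCat (κ : Cardinal.{u}) (J : Type u) [Category.{u} J] : Prop :=
  Cardinal.mk (Arrow J) ≤ κ

/-- The functor `F` creates the colimits of the diagram `K` in the strict sense: each colimit
cocone of `K ⋙ F` is the image under `F` (on the nose) of precisely one cocone of `K`, and that
cocone is a colimit of `K`. -/
def StrictlyCreatesColimit {J : Type*} [Category* J] {C : Type*} [Category* C]
    {D : Type*} [Category* D] (K : J ⥤ C) (F : C ⥤ D) : Prop :=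
  ∀ c : Cocone (K ⋙ F), Nonempty (IsColimit c) →
    ∃ d : Cocone K, F.mapCocone d = c ∧ (∀ d' : Cocone K, F.mapCocone d' = c → d' = d) ∧
      Nonempty (IsColimit d)

/-! Colimits: the legs of a colimit of carriers are jointly epic, so exactly one structure makes
them homomorphisms. Limits: a limit of `D` is a terminal cone. Every endofunctor `H` is set-based
(`exists_small_support`), so each element of a coalgebra comes from a small one
(`exists_small_subcoalgebra`), and each cone is a quotient of a coproduct of small cones, of which
at most `κ` suffice as representatives. Let `W` be the coproduct of these representatives, and glue
all elements of `W` that some cone morphism identifies. Every morphism out of this least quotient is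
injective, so every epimorphism out of it is invertible; coequalizers then give uniqueness and
pushouts existence of morphisms into it. -/

namespace ClassCat

variable {κ : Cardinal.{u}}

/-- A function between classes as a morphism of `ClassCat κ`. -/
abbrev homMk {X Y : ClassCat κ} (f : X.obj → Y.obj) : X ⟶ Y :=
  ObjectProperty.homMk (↾f)

theorem hom_ext_apply {X Y : ClassCat κ} {f g : X ⟶ Y} (h : ∀ x, f.hom x = g.hom x) : f = g := by
  apply ObjectProperty.hom_ext
  ext x
  exact h x

theorem map_map_apply (H : ClassCat κ ⥤ ClassCat κ) {X Y Z : ClassCat κ} (f : X ⟶ Y) (g : Y ⟶ Z)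
    (x : (H.obj X).obj) : (H.map g).hom ((H.map f).hom x) = (H.map (f ≫ g)).hom x := by
  rw [H.map_comp]; rfl

theorem map_id_apply (H : ClassCat κ ⥤ ClassCat κ) {X : ClassCat κ}
    (x : (H.obj X).obj) : (H.map (𝟙 X)).hom x = x := by
  rw [H.map_id]; rfl

end ClassCat

/-! ### Cardinal bounds below an inaccessible. -/

namespace Cardinal.IsInaccessible

variable {κ : Cardinal.{u}}

/-- A function is encoded by its graph, a subset of `A × K` of size below `κ = cof κ`; a strong
limit has only `κ` of these. -/
theorem mk_pi_le (hκ : κ.IsInaccessible) {A B : Type u} (hA : Cardinal.mk A < κ)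
    (hB : Cardinal.mk B ≤ κ) : Cardinal.mk (A → B) ≤ κ := by
  rcases isEmpty_or_nonempty A with h0 | h0
  · simpa using (hκ.isRegular.nat_lt 1).le
  obtain ⟨K, rfl⟩ : ∃ K : Type u, Cardinal.mk K = κ := ⟨κ.out, Cardinal.mk_out κ⟩
  obtain ⟨e⟩ : Nonempty (B ↪ K) := Cardinal.le_def B K |>.1 hB
  have hcard : Cardinal.mk (A × K) = Cardinal.mk K := by
    rw [← Cardinal.mul_def]
    exact Cardinal.mul_eq_right hκ.aleph0_lt.le hA.le (Cardinal.mk_ne_zero A)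
  have key := Cardinal.mk_subset_mk_lt_cof (α := A × K) (by rw [hcard]; exact hκ.isStrongPrelimit)
  rw [hcard, hκ.isRegular.cof_ord] at key
  refine le_of_le_of_eq (Cardinal.mk_le_of_injective
    (f := fun f : A → B => ⟨Set.range fun i => (i, e (f i)), ?_⟩) ?_) key
  rotate_left
  · exact Cardinal.mk_range_le.trans_lt hA
  · intro f g h
    have h' : (Set.range fun i => (i, e (f i))) = Set.range fun i => (i, e (g i)) :=
      congrArg Subtype.val h
    funext i
    obtain ⟨j, hj⟩ : (i, e (f i)) ∈ Set.range fun i => (i, e (g i)) := by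
      rw [← h']; exact ⟨i, rfl⟩
    simp only [Prod.mk.injEq, EmbeddingLike.apply_eq_iff_eq] at hj
    rw [← hj.2, hj.1]

theorem mk_sigma_le (hκ : κ.IsInaccessible) {A : Type u} {B : A → Type u}
    (hA : Cardinal.mk A ≤ κ) (hB : ∀ a, Cardinal.mk (B a) ≤ κ) :
    Cardinal.mk (Σ a, B a) ≤ κ := by
  rw [Cardinal.mk_sigma]
  calc Cardinal.sum (fun a => Cardinal.mk (B a)) ≤ Cardinal.sum (fun _ : A => κ) :=
        Cardinal.sum_le_sum _ _ hB
    _ = Cardinal.mk A * κ := by simp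
    _ ≤ κ * κ := by gcongr
    _ = κ := Cardinal.mul_eq_self hκ.aleph0_lt.le

end Cardinal.IsInaccessible

/-! ### Endofunctors of classes are set-based. -/

namespace ClassCat

variable {κ : Cardinal.{u}}

/-- The binary tree of height `κ`. -/
abbrev BinTree (κ : Cardinal.{u}) : Type u :=
  Σ a : κ.ord.ToType, (Set.Iio a → ULift.{u} Bool)

theorem mk_binTree_le (hκ : κ.IsInaccessible) : Cardinal.mk (BinTree κ) ≤ κ := by
  refine hκ.mk_sigma_le (by simp) fun a => hκ.mk_pi_le ?_ ?_
  · simpa using Cardinal.mk_Iio_lt a (by simp)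
  · exact (Cardinal.mk_le_aleph0).trans hκ.aleph0_lt.le

/-- The nodes on a branch of the binary tree. -/
def branch (b : κ.ord.ToType → ULift.{u} Bool) (a : κ.ord.ToType) : BinTree κ :=
  ⟨a, fun i => b i⟩

theorem exists_branch_retraction {b b' : κ.ord.ToType → ULift.{u} Bool} (hb : b ≠ b') :
    ∃ (m : κ.ord.ToType) (r : BinTree κ → κ.ord.ToType), (∀ a, r (branch b a) = a) ∧
      ∀ a, r (branch b' a) ≤ m := by
  classical
  obtain ⟨m, hm⟩ := Function.ne_iff.1 hb
  -- Nodes on `b` go to their level, all others to `m`. Above level `m` the branch `b'` has left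
  -- `b`.
  refine ⟨m, fun t => if t.2 = (branch b t.1).2 then t.1 else m, ?_, ?_⟩
  · intro a
    exact if_pos rfl
  · intro a
    dsimp only
    split_ifs with h
    · by_contra hlt
      exact hm (congrFun h ⟨m, not_le.1 hlt⟩).symm
    · exact le_rfl

/-- The `2 ^ κ` branches embed `κ` in the tree, but `H` of the tree has at most `κ` elements, so two
branches send `x` to the same element. Retracting onto one of them recovers `x` from the other,
whose retracted image is bounded, hence small. -/
theorem exists_small_support_of_ord (hκ : κ.IsInaccessible) (H : ClassCat κ ⥤ ClassCat κ)
    (hK : Cardinal.mk κ.ord.ToType ≤ κ)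
    (x : (H.obj ⟨κ.ord.ToType, hK⟩).obj) :
    ∃ (g : (⟨κ.ord.ToType, hK⟩ : ClassCat κ) ⟶ ⟨κ.ord.ToType, hK⟩),
      Cardinal.mk (Set.range g.hom) < κ ∧ (H.map g).hom x = x := by
  let T : ClassCat κ := ⟨BinTree κ, mk_binTree_le hκ⟩
  let K : ClassCat κ := ⟨κ.ord.ToType, hK⟩
  let t (b : κ.ord.ToType → ULift.{u} Bool) : K ⟶ T := homMk (branch b)
  have hni : ¬ Function.Injective fun b => (H.map (t b)).hom x := by
    intro hinj
    have h1 := Cardinal.mk_le_of_injective hinj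
    have h2 := h1.trans (H.obj T).property
    rw [← Cardinal.power_def] at h2
    simp only [Cardinal.mk_uLift, Cardinal.mk_bool, Cardinal.lift_ofNat, Cardinal.mk_toType, Cardinal.card_ord] at h2
    exact (Cardinal.cantor κ).not_ge h2
  simp only [Function.Injective, not_forall] at hni
  obtain ⟨b, b', hx, hne⟩ := hni
  obtain ⟨m, r, hr, hr'⟩ := exists_branch_retraction hne
  let ρ : T ⟶ K := homMk r
  refine ⟨t b' ≫ ρ, ?_, ?_⟩
  · have : Set.range (t b' ≫ ρ).hom ⊆ Set.Iic m := by
      rintro _ ⟨a, rfl⟩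
      exact hr' a
    refine (Cardinal.mk_le_mk_of_subset this).trans_lt ?_
    simpa using Cardinal.mk_Iic_lt m (by simp) (by simpa using hκ.aleph0_lt.le)
  · have h3 : t b ≫ ρ = 𝟙 K := hom_ext_apply hr
    rw [← map_map_apply, ← hx, map_map_apply, h3, map_id_apply]

/-- Every endofunctor of the category of classes is set-based. -/
theorem exists_small_support (hκ : κ.IsInaccessible) (H : ClassCat κ ⥤ ClassCat κ)
    (X : ClassCat κ) (x : (H.obj X).obj) :
    ∃ (Y : ClassCat κ) (i : Y ⟶ X) (y : (H.obj Y).obj), Cardinal.mk Y.obj < κ ∧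
      (H.map i).hom y = x := by
  rcases X.property.lt_or_eq with hX | hX
  · exact ⟨X, 𝟙 X, x, hX, map_id_apply H x⟩
  have hK : Cardinal.mk κ.ord.ToType ≤ κ := by simp
  obtain ⟨e⟩ : Nonempty (X.obj ≃ κ.ord.ToType) := Cardinal.eq.1 (by simpa using hX)
  let K : ClassCat κ := ⟨κ.ord.ToType, hK⟩
  let f : X ⟶ K := homMk e
  let f' : K ⟶ X := homMk e.symm
  have hf : f ≫ f' = 𝟙 X := hom_ext_apply fun z => e.symm_apply_apply z
  obtain ⟨g, hg, hgx⟩ := exists_small_support_of_ord hκ H hK ((H.map f).hom x)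
  let Y : ClassCat κ := ⟨Set.range g.hom, hg.le⟩
  let p : K ⟶ Y := homMk fun z => ⟨g.hom z, z, rfl⟩
  let j : Y ⟶ K := homMk Subtype.val
  have hpj : p ≫ j = g := hom_ext_apply fun z => rfl
  refine ⟨Y, j ≫ f', (H.map p).hom ((H.map f).hom x), hg, ?_⟩
  rw [← map_map_apply H j f', map_map_apply H p j, hpj, hgx, map_map_apply, hf, map_id_apply]

end ClassCat

/-! ### Colimits of coalgebras. -/

namespace CategoryTheory.Endofunctor.Coalgebra

variable {C : Type*} [Category* C] {F : C ⥤ C} {J : Type*} [Category* J]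
  {K : J ⥤ Coalgebra F}

theorem comp_str_comp_map {A B : Coalgebra F} (f : A ⟶ B) {X : C} {a : A.V ⟶ X} {b : B.V ⟶ X}
    (h : f.f ≫ b = a) : f.f ≫ B.str ≫ F.map b = A.str ≫ F.map a := by
  rw [← h, F.map_comp, ← Category.assoc, ← f.h, Category.assoc]

theorem comp_str_comp_map_of_fac {A B S : Coalgebra F} (i : A ⟶ B) (f : A ⟶ S) {d : B.V ⟶ S.V}
    (h : i.f ≫ d = f.f) : i.f ≫ B.str ≫ F.map d = i.f ≫ d ≫ S.str := by
  rw [comp_str_comp_map i h, f.h, ← h, Category.assoc]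

/-- The coalgebra structure on a colimit of the carriers of a diagram of coalgebras. -/
def liftColimitStr {c : Cocone (K ⋙ forget F)} (hc : IsColimit c) : c.pt ⟶ F.obj c.pt :=
  hc.desc
    { pt := F.obj c.pt
      ι :=
        { app := fun j => (K.obj j).str ≫ F.map (c.ι.app j)
          naturality := fun _ _ f =>
            (comp_str_comp_map (K.map f) (c.w f)).trans (Category.comp_id _).symm } }

theorem ι_liftColimitStr {c : Cocone (K ⋙ forget F)} (hc : IsColimit c) (j : J) :
    c.ι.app j ≫ liftColimitStr hc = (K.obj j).str ≫ F.map (c.ι.app j) :=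
  hc.fac _ j

/-- The cocone of coalgebras lying over a colimit cocone of carriers. -/
def liftCocone {c : Cocone (K ⋙ forget F)} (hc : IsColimit c) : Cocone K where
  pt := ⟨c.pt, liftColimitStr hc⟩
  ι :=
    { app := fun j => ⟨c.ι.app j, (ι_liftColimitStr hc j).symm⟩
      naturality := fun _ _ f => ext (c.ι.naturality f) }

/-- The lifted cocone is a colimit cocone of coalgebras. -/
def isColimitLiftCocone {c : Cocone (K ⋙ forget F)} (hc : IsColimit c) :
    IsColimit (liftCocone hc) where
  desc s :=
    { f := hc.desc ((forget F).mapCocone s)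
      h := hc.hom_ext fun j => by
        exact comp_str_comp_map_of_fac ((liftCocone hc).ι.app j) (s.ι.app j)
          (hc.fac ((forget F).mapCocone s) j) }
  fac s j := ext (hc.fac ((forget F).mapCocone s) j)
  uniq s m hm := ext (hc.uniq ((forget F).mapCocone s) m.f fun j => congrArg Hom.f (hm j))

theorem strictlyCreatesColimit_forget (K : J ⥤ Coalgebra F) :
    StrictlyCreatesColimit K (forget F) := by
  rintro c ⟨hc⟩
  refine ⟨liftCocone hc, rfl, ?_, ⟨isColimitLiftCocone hc⟩⟩
  rintro ⟨⟨V, str⟩, ι⟩ rfl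
  have h : str = liftColimitStr hc := hc.hom_ext fun j =>
    ((ι.app j).h.symm).trans (ι_liftColimitStr hc j).symm
  -- The structure is made a variable so that `h` can be substituted inside the dependent legs.
  have key : ∀ (t : V ⟶ F.obj V) (n : K ⟶ (Functor.const J).obj ⟨V, t⟩), str = t →
      (∀ j, (ι.app j).f = (n.app j).f) →
      (⟨⟨V, str⟩, ι⟩ : Cocone K) = ⟨⟨V, t⟩, n⟩ := by
    rintro t n rfl hn
    congr 1
    ext j
    exact hn j
  exact key _ _ h fun _ => rfl

instance createsColimitForget (K : J ⥤ Coalgebra F) : CreatesColimit K (forget F) :=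
  createsColimitOfReflectsIso fun _ hc =>
    { liftedCocone := liftCocone hc
      validLift := Iso.refl _
      makesColimit := isColimitLiftCocone hc }

instance createsColimitsOfShapeForget : CreatesColimitsOfShape J (forget F) where

end CategoryTheory.Endofunctor.Coalgebra

/-! ### Colimits of classes. -/

namespace ClassCat

variable {κ : Cardinal.{u}}

theorem mk_le_of_isColimit (hκ : κ.IsInaccessible) {J : Type u} [Category.{u} J]
    (hJ : Cardinal.mk J ≤ κ) {F : J ⥤ Type u} {c : Cocone F} (hc : IsColimit c)
    (hF : ∀ j, Cardinal.mk (F.obj j) ≤ κ) : Cardinal.mk c.pt ≤ κ := by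
  refine le_trans (Cardinal.mk_le_of_surjective
    (f := fun p : Σ j, F.obj j => c.ι.app p.1 p.2) fun x => ?_) (hκ.mk_sigma_le hJ hF)
  obtain ⟨j, y, h⟩ := Types.jointly_surjective F hc x
  exact ⟨⟨j, y⟩, h⟩

theorem isClosedUnderColimitsOfShape (hκ : κ.IsInaccessible) (J : Type u) [Category.{u} J]
    (hJ : Cardinal.mk J ≤ κ) :
    ObjectProperty.IsClosedUnderColimitsOfShape (fun X : Type u => Cardinal.mk X ≤ κ) J where
  colimitsOfShape_le := by
    rintro X ⟨p⟩
    exact mk_le_of_isColimit hκ hJ p.isColimit p.prop_diag_obj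

/-- Serves `WalkingSpan` and `WalkingParallelPair`, which live in `Type`. -/
theorem isClosedUnderColimitsOfShape_of_countable (hκ : κ.IsInaccessible) (J : Type)
    [SmallCategory J] [Countable J] :
    ObjectProperty.IsClosedUnderColimitsOfShape (fun X : Type u => Cardinal.mk X ≤ κ) J := by
  have := isClosedUnderColimitsOfShape hκ (ULiftHom.{u} (ULift.{u} J))
    ((Cardinal.mk_le_aleph0 (α := ULift.{u} J)).trans hκ.aleph0_lt.le)
  exact .of_equivalence (ULiftHomULiftCategory.equiv J).symm

end ClassCat

theorem IsClassSizedCat.mk_le {κ : Cardinal.{u}} {J : Type u} [Category.{u} J]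
    (hJ : IsClassSizedCat κ J) : Cardinal.mk J ≤ κ :=
  (Cardinal.mk_le_of_injective (f := fun j : J => Arrow.mk (𝟙 j))
    fun _ _ h => congrArg Comma.left h).trans hJ

theorem IsSmallCat.mk_lt {κ : Cardinal.{u}} {J : Type u} [Category.{u} J]
    (hJ : IsSmallCat κ J) : Cardinal.mk J < κ :=
  (Cardinal.mk_le_of_injective (f := fun j : J => Arrow.mk (𝟙 j))
    fun _ _ h => congrArg Comma.left h).trans_lt hJ

/-! ### Small subcoalgebras. -/

namespace ClassCat

variable {κ : Cardinal.{u}}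

/-- Closing up takes `ω` steps; regularity and `ℵ₀ < κ` keep each stage and the union small. -/
theorem exists_small_closed_set (hκ : κ.IsInaccessible) {A : Type u} (a : A) (t : A → Set A)
    (ht : ∀ x, Cardinal.mk (t x) < κ) :
    ∃ S : Set A, a ∈ S ∧ Cardinal.mk S < κ ∧ ∀ x ∈ S, t x ⊆ S := by
  let step (S : Set A) : Set A := ⋃ x ∈ S, t x
  let S (n : ULift.{u} ℕ) : Set A := step^[n.down] {a}
  have hS : ∀ n : ℕ, Cardinal.mk (step^[n] {a} : Set A) < κ := by
    intro n
    induction n with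
    | zero => simpa using hκ.nat_lt 1
    | succ n ih =>
      rw [Function.iterate_succ_apply']
      exact (Cardinal.card_biUnion_lt_iff_forall_of_isRegular hκ.isRegular ih).2 fun x _ => ht x
  refine ⟨⋃ n, S n, Set.mem_iUnion.2 ⟨⟨0⟩, rfl⟩, ?_, ?_⟩
  · refine (Cardinal.card_iUnion_lt_iff_forall_of_isRegular hκ.isRegular ?_).2 fun n => hS n.down
    exact (Cardinal.mk_le_aleph0 (α := ULift.{u} ℕ)).trans_lt hκ.aleph0_lt
  · intro x hx z hz
    obtain ⟨⟨n⟩, hn⟩ := Set.mem_iUnion.1 hx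
    refine Set.mem_iUnion.2 ⟨⟨n + 1⟩, ?_⟩
    change z ∈ step^[n + 1] {a}
    rw [Function.iterate_succ_apply']
    exact Set.mem_biUnion hn hz

open Endofunctor

/-- Once `S` contains a support of the structure value at each of its points, those values lift to
`H S`; a choice of lifts is enough. -/
theorem exists_small_subcoalgebra (hκ : κ.IsInaccessible) {H : ClassCat κ ⥤ ClassCat κ}
    (A : Coalgebra H) (a : A.V.obj) :
    ∃ (S : Coalgebra H) (f : S ⟶ A) (s : S.V.obj), Cardinal.mk S.V.obj < κ ∧ f.f.hom s = a := by
  choose Y i y hY hy using fun x => exists_small_support hκ H A.V (A.str.hom x)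
  obtain ⟨S, haS, hS, hcl⟩ := exists_small_closed_set hκ a (fun x => Set.range (i x).hom)
    fun x => Cardinal.mk_range_le.trans_lt (hY x)
  let V : ClassCat κ := ⟨S, hS.le⟩
  let ι : V ⟶ A.V := homMk Subtype.val
  let l (x : S) : Y x ⟶ V := homMk fun z => ⟨(i x).hom z, hcl x x.2 ⟨z, rfl⟩⟩
  have hl (x : S) : l x ≫ ι = i x := hom_ext_apply fun _ => rfl
  let str : V ⟶ H.obj V := homMk fun x => (H.map (l x)).hom (y x)
  refine ⟨⟨V, str⟩, ⟨ι, hom_ext_apply fun x => ?_⟩, ⟨a, haS⟩, hS, rfl⟩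
  change (H.map ι).hom ((H.map (l x)).hom (y x)) = A.str.hom x.1
  rw [map_map_apply, hl, hy]

/-- The subsets of a fixed set of cardinality `κ` with fewer than `κ` elements. -/
abbrev SmallSubset (κ : Cardinal.{u}) : Type u := {s : Set κ.out // Cardinal.mk s < κ}

theorem mk_smallSubset (hκ : κ.IsInaccessible) : Cardinal.mk (SmallSubset κ) = κ := by
  have key := Cardinal.mk_subset_mk_lt_cof (α := κ.out)
    (by rw [Cardinal.mk_out]; exact hκ.isStrongPrelimit)
  rwa [Cardinal.mk_out, hκ.isRegular.cof_ord] at key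

/-- A small subset as an object of the category of classes. -/
abbrev SmallSubset.toClassCat (s : SmallSubset κ) : ClassCat κ := ⟨s.1, s.2.le⟩

theorem exists_smallSubset_coalgebra (hκ : κ.IsInaccessible) {H : ClassCat κ ⥤ ClassCat κ}
    (A : Coalgebra H) (a : A.V.obj) :
    ∃ (s : SmallSubset κ) (σ : s.toClassCat ⟶ H.obj s.toClassCat)
      (f : (⟨s.toClassCat, σ⟩ : Coalgebra H) ⟶ A) (x : s.1), f.f.hom x = a := by
  obtain ⟨S, f, x, hS, hx⟩ := exists_small_subcoalgebra hκ A a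
  obtain ⟨e⟩ : Nonempty (S.V.obj ↪ κ.out) := by
    rw [← Cardinal.le_def, Cardinal.mk_out]
    exact hS.le
  let s : SmallSubset κ := ⟨Set.range e, Cardinal.mk_range_le.trans_lt hS⟩
  let ε : S.V.obj ≃ s.1 := Equiv.ofInjective e e.injective
  let p : S.V ⟶ s.toClassCat := homMk ε
  let q : s.toClassCat ⟶ S.V := homMk ε.symm
  have hpq : p ≫ q = 𝟙 _ := hom_ext_apply fun z => ε.symm_apply_apply z
  refine ⟨s, q ≫ S.str ≫ H.map p, ⟨q ≫ f.f, ?_⟩, ε x, ?_⟩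
  · simp only [Category.assoc, ← H.map_comp]
    rw [← Category.assoc p, hpq, Category.id_comp, f.h]
  · change f.f.hom (ε.symm (ε x)) = a
    rw [Equiv.symm_apply_apply, hx]

end ClassCat

/-! ### Colimits of cones. -/

namespace CategoryTheory.Limits.Cone

variable {C : Type*} [Category* C] {J : Type*} [Category* J] (D : J ⥤ C)
  (I : Type*) [Category* I]

/-- Cones over `D` are arrows from constant diagrams to `D`, so this lets their colimits be formed
on apexes. -/
theorem preservesColimitsOfShape_const :
    PreservesColimitsOfShape I (Functor.const J : C ⥤ J ⥤ C) :=
  preservesColimitsOfShape_of_evaluation _ _ fun _ =>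
    preservesColimitsOfShape_of_natIso (Functor.constCompEvaluationObj _ _).symm

variable [HasColimitsOfShape I C]

instance hasColimitsOfShape_cone : HasColimitsOfShape I (Cone D) :=
  have := preservesColimitsOfShape_const (C := C) (J := J) I
  Adjunction.hasColimitsOfShape_of_equivalence (equivCostructuredArrow D).functor

instance preservesColimitsOfShape_forget : PreservesColimitsOfShape I (Cone.forget D) := by
  have := preservesColimitsOfShape_const (C := C) (J := J) I
  have e : (equivCostructuredArrow D).functor ⋙ CostructuredArrow.proj _ _ ≅ Cone.forget D :=
    NatIso.ofComponents (fun _ => Iso.refl _) fun _ =>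
      (Category.comp_id _).trans (Category.id_comp _).symm
  exact preservesColimitsOfShape_of_natIso e

instance : (Cone.forget D).Faithful where
  map_injective h := ConeMorphism.ext _ _ h

instance : (Cone.forget D).ReflectsIsomorphisms where
  reflects f hf :=
    have : IsIso f.hom := hf
    Cone.cone_iso_of_hom_iso f

end CategoryTheory.Limits.Cone

/-! ### The terminal cone. -/

namespace ClassCat
open Endofunctor

variable {κ : Cardinal.{u}} {H : ClassCat κ ⥤ ClassCat κ} {J : Type u} [Category.{u} J]
  (D : J ⥤ Coalgebra H)

/-- The underlying set of a cone of coalgebras. -/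
abbrev coneCarrier : Cone D ⥤ Type u :=
  Cone.forget D ⋙ Coalgebra.forget H ⋙ ObjectProperty.ι _

theorem hasColimitsOfShape (hκ : κ.IsInaccessible) (I : Type u) [Category.{u} I]
    (hI : Cardinal.mk I ≤ κ) : HasColimitsOfShape I (ClassCat κ) :=
  have := isClosedUnderColimitsOfShape hκ I hI
  inferInstance

theorem hasColimitsOfShape_coalgebra [HasColimitsOfShape J (ClassCat κ)] :
    HasColimitsOfShape J (Coalgebra H) :=
  hasColimitsOfShape_of_hasColimitsOfShape_createsColimitsOfShape (Coalgebra.forget H)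

theorem hasColimitsOfShape_of_countable (hκ : κ.IsInaccessible) (I : Type) [SmallCategory I]
    [Countable I] : HasColimitsOfShape I (Cone D) :=
  have := isClosedUnderColimitsOfShape_of_countable hκ I
  have : HasColimitsOfShape I (Coalgebra H) :=
    hasColimitsOfShape_of_hasColimitsOfShape_createsColimitsOfShape (Coalgebra.forget H)
  inferInstance

theorem preservesColimitsOfShape_coneCarrier (hκ : κ.IsInaccessible) (I : Type) [SmallCategory I]
    [Countable I] : PreservesColimitsOfShape I (coneCarrier D) :=
  have := isClosedUnderColimitsOfShape_of_countable hκ I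
  have : HasColimitsOfShape I (Coalgebra H) :=
    hasColimitsOfShape_of_hasColimitsOfShape_createsColimitsOfShape (Coalgebra.forget H)
  inferInstance

variable {D}

/-- The carrier functor preserves pushouts, hence epimorphisms. -/
theorem surjective_of_epi (hκ : κ.IsInaccessible) {X Y : Cone D} (f : X ⟶ Y) [Epi f] :
    Function.Surjective f.hom.f.hom := by
  have := preservesColimitsOfShape_coneCarrier D hκ WalkingSpan
  exact (epi_iff_surjective _).1 (inferInstanceAs (Epi ((coneCarrier D).map f)))

theorem epi_of_surjective {X Y : Cone D} (f : X ⟶ Y) (hf : Function.Surjective f.hom.f.hom) :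
    Epi f :=
  (coneCarrier D).epi_of_epi_map ((epi_iff_surjective ((coneCarrier D).map f)).2 hf)

theorem isIso_of_bijective {X Y : Cone D} (f : X ⟶ Y) (hf : Function.Bijective f.hom.f.hom) :
    IsIso f := by
  have : IsIso ((coneCarrier D).map f) := (isIso_iff_bijective _).2 hf
  exact isIso_of_reflects_iso f (coneCarrier D)

/-- Two elements of a cone of coalgebras are identified by some morphism of cones. -/
def Identified (W : Cone D) (w w' : W.pt.V.obj) : Prop :=
  ∃ (Q : Cone D) (q : W ⟶ Q), q.hom.f.hom w = q.hom.f.hom w'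

/-- The carrier of the least quotient of a cone of coalgebras. -/
abbrev leastQuotientCarrier (W : Cone D) : ClassCat κ :=
  ⟨Quot (Identified W), Cardinal.mk_quot_le.trans W.pt.V.property⟩

/-- The projection of a cone of coalgebras onto its least quotient. -/
abbrev leastQuotientProj (W : Cone D) : W.pt.V ⟶ leastQuotientCarrier W :=
  homMk (Quot.mk _)

theorem exists_leastQuotientProj_factor {W Q : Cone D} (q : W ⟶ Q) (w₀ : W.pt.V.obj) :
    ∃ p : Q.pt.V ⟶ leastQuotientCarrier W, q.hom.f ≫ p = leastQuotientProj W := by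
  classical
  let p (z : Q.pt.V.obj) : Quot (Identified W) :=
    -- Off the image of `q` any value will do; `w₀` provides one.
    if h : ∃ w, q.hom.f.hom w = z then Quot.mk _ h.choose else Quot.mk _ w₀
  refine ⟨homMk p, hom_ext_apply fun w => ?_⟩
  have h : ∃ w', q.hom.f.hom w' = q.hom.f.hom w := ⟨w, rfl⟩
  change p (q.hom.f.hom w) = Quot.mk _ w
  rw [show p (q.hom.f.hom w) = Quot.mk _ h.choose from dif_pos h]
  exact Quot.sound ⟨Q, q, h.choose_spec⟩

/-- The projection factors through `q` as a function, so both sides depend only on the images of `w`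
and `w'` under `q`. -/
theorem map_leastQuotientProj_str {W : Cone D} {w w' : W.pt.V.obj} (h : Identified W w w') :
    (H.map (leastQuotientProj W)).hom (W.pt.str.hom w) =
      (H.map (leastQuotientProj W)).hom (W.pt.str.hom w') := by
  obtain ⟨Q, q, hq⟩ := h
  obtain ⟨p, hp⟩ := exists_leastQuotientProj_factor q w
  have key (v) : (H.map (leastQuotientProj W)).hom (W.pt.str.hom v) =
      (H.map p).hom (Q.pt.str.hom (q.hom.f.hom v)) := by
    have h1 : (H.map q.hom.f).hom (W.pt.str.hom v) = Q.pt.str.hom (q.hom.f.hom v) :=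
      ConcreteCategory.congr_hom (congrArg InducedCategory.Hom.hom q.hom.h) v
    rw [← h1, map_map_apply, hp]
  rw [key, key, hq]

/-- The least quotient of a cone of coalgebras, as a coalgebra. -/
abbrev leastQuotientCoalgebra (W : Cone D) : Coalgebra H where
  V := leastQuotientCarrier W
  str := homMk (Quot.lift (fun w => (H.map (leastQuotientProj W)).hom (W.pt.str.hom w))
    fun _ _ => map_leastQuotientProj_str)

theorem π_apply_eq {W : Cone D} {w w' : W.pt.V.obj} (h : Identified W w w') (j : J) :
    (W.π.app j).f.hom w = (W.π.app j).f.hom w' := by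
  obtain ⟨Q, q, hq⟩ := h
  have key (v) : (W.π.app j).f.hom v = (Q.π.app j).f.hom (q.hom.f.hom v) := by
    rw [← q.w j]; rfl
  rw [key, key, hq]

/-- The legs of the least quotient of a cone of coalgebras. -/
abbrev leastQuotientLeg (W : Cone D) (j : J) : leastQuotientCoalgebra W ⟶ D.obj j where
  f := homMk (Quot.lift (fun w => (W.π.app j).f.hom w) fun _ _ h => π_apply_eq h j)
  h := hom_ext_apply <| Quot.ind fun w => by
    change (H.map _).hom ((H.map (leastQuotientProj W)).hom (W.pt.str.hom w)) = _
    rw [map_map_apply]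
    exact ConcreteCategory.congr_hom (congrArg InducedCategory.Hom.hom (W.π.app j).h) w

/-- The least quotient of a cone of coalgebras. -/
abbrev leastQuotient (W : Cone D) : Cone D where
  pt := leastQuotientCoalgebra W
  π :=
    { app := leastQuotientLeg W
      naturality := fun i j f => Coalgebra.ext <| hom_ext_apply <| Quot.ind fun w => by
        change (W.π.app j).f.hom w = (D.map f).f.hom ((W.π.app i).f.hom w)
        rw [← W.w f]
        rfl }

/-- The projection of a cone of coalgebras onto its least quotient. -/
def leastQuotientMk (W : Cone D) : W ⟶ leastQuotient W where
  hom := ⟨leastQuotientProj W, hom_ext_apply fun _ => rfl⟩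
  w _ := rfl

theorem injective_leastQuotient {W Q : Cone D} (q : leastQuotient W ⟶ Q) :
    Function.Injective q.hom.f.hom := by
  intro x y
  induction x using Quot.ind with | _ x
  induction y using Quot.ind with | _ y
  intro h
  exact Quot.sound ⟨Q, leastQuotientMk W ≫ q, h⟩

theorem isIso_of_epi_leastQuotient (hκ : κ.IsInaccessible) {W Q : Cone D}
    (q : leastQuotient W ⟶ Q) [Epi q] : IsIso q :=
  isIso_of_bijective q ⟨injective_leastQuotient q, surjective_of_epi hκ q⟩

/-- The coequalizer of two such morphisms is an epimorphism out of the least quotient, hence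
invertible. -/
theorem subsingleton_hom_leastQuotient (hκ : κ.IsInaccessible) (W X : Cone D) :
    Subsingleton (X ⟶ leastQuotient W) where
  allEq f g := by
    have := hasColimitsOfShape_of_countable D hκ WalkingParallelPair
    have := isIso_of_epi_leastQuotient hκ (coequalizer.π f g)
    exact (cancel_mono (coequalizer.π f g)).1 (coequalizer.condition f g)

theorem mk_hom_const_le (hκ : κ.IsInaccessible) (hJ : Cardinal.mk J < κ) (A : Coalgebra H)
    (hA : Cardinal.mk A.V.obj < κ) : Cardinal.mk ((Functor.const J).obj A ⟶ D) ≤ κ := by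
  have e (j : J) : Nonempty ((D.obj j).V.obj ↪ κ.out) := by
    rw [← Cardinal.le_def, Cardinal.mk_out]
    exact (D.obj j).V.property
  replace e (j : J) := (e j).some
  refine (Cardinal.mk_le_of_injective (f := fun (t : (Functor.const J).obj A ⟶ D)
    (p : J × A.V.obj) => e p.1 ((t.app p.1).f.hom p.2)) fun t t' h => ?_).trans
      (hκ.mk_pi_le (A := J × A.V.obj) ?_ (Cardinal.mk_out κ).le)
  · ext j : 2
    exact Coalgebra.ext (hom_ext_apply fun x => (e j).injective (congrFun h (j, x)))
  · rw [← Cardinal.mul_def]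
    exact Cardinal.mul_lt_of_lt hκ.aleph0_lt.le hJ hA

/-- The small cones carried by small subsets of a fixed set of cardinality `κ`. -/
abbrev SmallCone (D : J ⥤ Coalgebra H) : Type u :=
  Σ (s : SmallSubset κ) (σ : s.toClassCat ⟶ H.obj s.toClassCat),
    (Functor.const J).obj (⟨s.toClassCat, σ⟩ : Coalgebra H) ⟶ D

/-- The cone of coalgebras given by a small cone. -/
abbrev SmallCone.toCone (S : SmallCone D) : Cone D := ⟨⟨S.1.toClassCat, S.2.1⟩, S.2.2⟩

theorem mk_smallCone_le (hκ : κ.IsInaccessible) (hJ : Cardinal.mk J < κ) :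
    Cardinal.mk (SmallCone D) ≤ κ := by
  refine hκ.mk_sigma_le (mk_smallSubset hκ).le fun s => hκ.mk_sigma_le ?_ fun σ =>
    mk_hom_const_le hκ hJ _ s.2
  refine (Cardinal.mk_le_of_injective (f := fun σ : s.toClassCat ⟶ H.obj s.toClassCat =>
    (σ.hom : s.1 → (H.obj s.toClassCat).obj)) ?_).trans (hκ.mk_pi_le s.2 (H.obj _).property)
  exact fun f g h => hom_ext_apply (congrFun h)

theorem exists_smallCone (hκ : κ.IsInaccessible) (X : Cone D) (x : X.pt.V.obj) :
    ∃ (S : SmallCone D) (f : S.toCone ⟶ X) (y : S.toCone.pt.V.obj), f.hom.f.hom y = x := by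
  obtain ⟨s, σ, f, y, hy⟩ := exists_smallSubset_coalgebra hκ X.pt x
  exact ⟨⟨s, σ, (Functor.const J).map f ≫ X.π⟩, ⟨f, fun _ => rfl⟩, y, hy⟩

theorem hasCoproduct_cone (hκ : κ.IsInaccessible) {I : Type u} (hI : Cardinal.mk I ≤ κ)
    (f : I → Cone D) : HasCoproduct f := by
  have := hasColimitsOfShape hκ (Discrete I) (by
    rwa [Cardinal.mk_congr discreteEquiv])
  have : HasColimitsOfShape (Discrete I) (Coalgebra H) := hasColimitsOfShape_coalgebra
  infer_instance

theorem nonempty_hom_leastQuotient (hκ : κ.IsInaccessible)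
    [HasCoproduct (SmallCone.toCone (D := D))] (X : Cone D) :
    Nonempty (X ⟶ leastQuotient (∐ SmallCone.toCone (D := D))) := by
  choose S f y hy using exists_smallCone hκ X
  have := hasCoproduct_cone hκ X.pt.V.property fun x => (S x).toCone
  have := hasColimitsOfShape_of_countable D hκ WalkingSpan
  -- One small cone for each element of `X`, so that `p` is onto.
  let p : (∐ fun x => (S x).toCone) ⟶ X := Sigma.desc f
  have hp : Epi p := epi_of_surjective p fun x => by
    refine ⟨(Sigma.ι (fun x => (S x).toCone) x).hom.f.hom (y x), ?_⟩
    refine Eq.trans ?_ (hy x)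
    rw [← Sigma.ι_desc (f := fun x => (S x).toCone) f x]
    rfl
  let e : (∐ fun x => (S x).toCone) ⟶ leastQuotient (∐ SmallCone.toCone (D := D)) :=
    Sigma.desc (fun x => Sigma.ι (SmallCone.toCone (D := D)) (S x)) ≫ leastQuotientMk _
  -- As a pushout of the epimorphism `p`, this leg is epic.
  have := isIso_of_epi_leastQuotient hκ (pushout.inr p e)
  exact ⟨pushout.inl p e ≫ inv (pushout.inr p e)⟩

theorem hasLimit_coalgebra (hκ : κ.IsInaccessible) (hJ : Cardinal.mk J < κ) : HasLimit D := by
  rw [hasLimit_iff_hasTerminal_cone]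
  have := hasCoproduct_cone hκ (mk_smallCone_le hκ hJ) (SmallCone.toCone (D := D))
  have h1 := nonempty_hom_leastQuotient (D := D) hκ
  have h2 := subsingleton_hom_leastQuotient hκ (∐ SmallCone.toCone (D := D))
  exact hasTerminal_of_unique (leastQuotient (∐ SmallCone.toCone (D := D)))

end ClassCat

theorem mainTheorem11 (κ : Cardinal.{u}) (hκ : κ.IsInaccessible)
    (H : ClassCat κ ⥤ ClassCat κ) :
    (∀ (J : Type u) [Category.{u} J], IsSmallCat κ J →
      HasLimitsOfShape J (Endofunctor.Coalgebra H)) ∧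
    (∀ (J : Type u) [Category.{u} J], IsClassSizedCat κ J →
      HasColimitsOfShape J (Endofunctor.Coalgebra H) ∧
      Nonempty (CreatesColimitsOfShape J (Endofunctor.Coalgebra.forget H)) ∧
      ∀ K : J ⥤ Endofunctor.Coalgebra H,
        StrictlyCreatesColimit K (Endofunctor.Coalgebra.forget H)) := by
  refine ⟨fun J _ hJ => ⟨fun D => ClassCat.hasLimit_coalgebra hκ hJ.mk_lt⟩, fun J _ hJ => ?_⟩
  have := ClassCat.hasColimitsOfShape hκ J hJ.mk_le
  exact ⟨ClassCat.hasColimitsOfShape_coalgebra, ⟨inferInstance⟩,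
    Endofunctor.Coalgebra.strictlyCreatesColimit_forget⟩
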